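/- Let $R$ be a commutative ring with unity, $x=(x_1,\dots,x_n)$ variables, $y=(y_1,\dots,y_n)$ a second copy of them, and $f=(f_1,\dots,f_n)$ polynomials in $R[x]$. Let $(f(x))_x$ be the ideal of $R[x]$ generated by $f_1,\dots,f_n$, let $\delta_f=\sum_{i=1}^n(\deg f_i-1)$, and for an integer $d$ let $R[x^{\le d}]$ be the module of polynomials of total degree $\le d$ (it is $0$ if $d<0$). A functional is an $R$-linear map $L:R[x]\to R$; it annuls a set if it vanishes on it; $L(y_*).G(x,y)\in R[x]$ is the result of applying $L$ to $G(x,y)$ as a polynomial in $y$ with coefficients in $R[x]$; and $L\cdot G$, for $G\in R[x]$, is the functional $F\mapsto L(GF)$. For a polynomial $F$, a choice of $\nabla F(x,y)$ is a column $(\nabla^1F,\dots,\nabla^nF)$ of polynomials in $(x,y)$ of total degree $\le\deg F-1$ (zero if $F$ is constant) with $F(x)-F(y)=\sum_k(x_k-y_k)\nabla^kF(x,y)$. Fix any choices $\nabla f_i(x,y)$, $i=1,\dots,n$, put $\nabla f(x,y)=(\nabla f_1,\dots,\nabla f_n)$ (an $n\times n$ matrix), and fix any $R$-linear choice $F\mapsto\nabla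 F(x,y)$ on $R[x]$. For functionals $l,L$ and $F\in R[x]$ put $$L*F=L(y_*).\det\begin{pmatrix}\nabla f(x,y)&\nabla F(x,y)\\ f(x)&F(x)\end{pmatrix}\in R[x],\qquad (l*L)(F)=l(L*F).$$ Let $E$ be a unit root functional of $f$: a functional that annuls $(f(x))_x$ and satisfies $E*1-1\in(f(x))_x$. Then: 1) If $F\in R[x^{\le d}]$, then $E*F\in R[x^{\le\delta_f}]$ and $F-E*F\in(f(x))_x\cap R[x^{\le\max(\delta_f,d)}]$. 2) If a functional $l$ annuls $(f(x))_x$, then $l=E*l=l*E=E\cdot\bigl(l(y_*).\det\nabla f(x,y)\bigr)$. 3) If $l$ annuls $(f(x))_x$, $\delta\ge0$ is an integer, and a functional $L'$ agrees with $l$ on $R[x^{\le\delta_f+\delta}]$, then $l=E*L'=L'*E$ on all of $R[x]$. 4) If $\delta\ge0$ and a functional $L$ annuls $(f(x))_x\cap R[x^{\le\delta_f+\delta}]$, then $L=E*L=L*E$ on $R[x^{\le\delta_f+\delta}]$; moreover $E*L=L*E$ on all of $R[x]$, and this functional annuls $(f(x))_x$. 5) If $l$ annuls $(f(x))_x$ and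 $\delta\ge0$, then $l$ is uniquely determined by its action on $R[x^{\le\delta_f+\delta}]$: two functionals that annul $(f(x))_x$ and agree on $R[x^{\le\delta_f+\delta}]$ are equal. -/

import Mathlib

open MvPolynomial

namespace RootFunctional

/-- The linear functionals on `R[x]`, where `x = (x_1, ..., x_n)`. -/
abbrev Functional (n : ℕ) (R : Type*) [CommRing R] : Type _ :=
  MvPolynomial (Fin n) R →ₗ[R] R

/-- `R[z^{≤ d}]`: the polynomials in the variables `z` of total degree at most the integer `d`
(for `d < 0` only the zero polynomial). -/
def degLE (σ R : Type*) [CommRing R] (d : ℤ) : Submodule R (MvPolynomial σ R) where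
  carrier := {F | ∀ s ∈ F.support, ((s.degree : ℕ) : ℤ) ≤ d}
  zero_mem' := by simp
  add_mem' := by
    classical
    intro F G hF hG s hs
    rcases Finset.mem_union.1 (MvPolynomial.support_add hs) with h | h
    · exact hF s h
    · exact hG s h
  smul_mem' := by
    intro c F hF s hs
    exact hF s (MvPolynomial.support_smul hs)

variable {n : ℕ} {R : Type*} [CommRing R]

/-- `F(x)` as a polynomial in `(x, y)`; the variables `x` are indexed by the left summand. -/
noncomputable def inX (F : MvPolynomial (Fin n) R) : MvPolynomial (Fin n ⊕ Fin n) R :=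
  rename Sum.inl F

/-- `F(y)` as a polynomial in `(x, y)`; the variables `y` are indexed by the right summand. -/
noncomputable def inY (F : MvPolynomial (Fin n) R) : MvPolynomial (Fin n ⊕ Fin n) R :=
  rename Sum.inr F

/-- `D = (D^1, ..., D^n)` is a choice of `∇F(x, y)`: the polynomials `D^k` in `(x, y)` satisfy
`F(x) - F(y) = ∑_k (x_k - y_k) D^k(x, y)` and have total degree at most `deg F - 1`
in `(x, y)` (so `D = 0` if `F` is constant). -/
def IsNabla (F : MvPolynomial (Fin n) R) (D : Fin n → MvPolynomial (Fin n ⊕ Fin n) R) : Prop :=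
  inX F - inY F = ∑ k, (X (Sum.inl k) - X (Sum.inr k)) * D k ∧
    ∀ k, D k ∈ degLE (Fin n ⊕ Fin n) R ((F.totalDegree : ℤ) - 1)

/-- `nab` is a choice of the `R`-linear operator `∇_x(x, y)`. -/
def IsNablaOperator
    (nab : MvPolynomial (Fin n) R →ₗ[R] (Fin n → MvPolynomial (Fin n ⊕ Fin n) R)) : Prop :=
  ∀ F, IsNabla F (nab F)

/-- `δ_f = ∑_i (deg f_i - 1)`. -/
def delta (f : Fin n → MvPolynomial (Fin n) R) : ℤ :=
  ∑ i, (((f i).totalDegree : ℤ) - 1)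

/-- The ideal `(f(x))_x` generated by `f_1, ..., f_n`. -/
noncomputable def idealOf (f : Fin n → MvPolynomial (Fin n) R) : Ideal (MvPolynomial (Fin n) R) :=
  Ideal.span (Set.range f)

/-- `L(x_*)` annuls `(f(x))_x`. -/
def AnnulsIdeal (L : Functional n R) (f : Fin n → MvPolynomial (Fin n) R) : Prop :=
  ∀ F ∈ idealOf f, L F = 0

/-- `L(y_*).G(x, y)`: the functional `L` acts on the variables `y`, over `R[x]`, so that
`x^a y^b` goes to `L(x^b) x^a`. -/
noncomputable def applyY (L : Functional n R) :
    MvPolynomial (Fin n ⊕ Fin n) R →ₗ[R] MvPolynomial (Fin n) R :=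
  (basisMonomials (Fin n ⊕ Fin n) R).constr R fun m =>
    L (monomial (Finsupp.sumFinsuppEquivProdFinsupp m).2 1) •
      monomial (Finsupp.sumFinsuppEquivProdFinsupp m).1 1

theorem applyY_inX_mul_inY (L : Functional n R) (P Q : MvPolynomial (Fin n) R) :
    applyY L (inX P * inY Q) = L Q • P := by
  induction P using MvPolynomial.induction_on' with
  | add p q hp hq =>
    simp only [inX, map_add, add_mul, smul_add] at *
    rw [hp, hq]
  | monomial a r =>
    induction Q using MvPolynomial.induction_on' with
    | add p q hp hq =>
      simp only [inY, map_add, mul_add, add_smul] at *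
      rw [hp, hq]
    | monomial b s =>
      have h : inX (monomial a r) * inY (monomial b s) =
          (r * s) • basisMonomials (Fin n ⊕ Fin n) R
            (Finsupp.sumFinsuppEquivProdFinsupp.symm (a, b)) := by
        have e : a.mapDomain Sum.inl + b.mapDomain Sum.inr =
            Finsupp.sumFinsuppEquivProdFinsupp.symm (a, b) := by
          ext i
          rcases i with i | i
          · simp [Finsupp.mapDomain_apply Sum.inl_injective, Finsupp.mapDomain_of_notMem_range]
          · simp [Finsupp.mapDomain_apply Sum.inr_injective, Finsupp.mapDomain_of_notMem_range]
        simp [inX, inY, rename_monomial, monomial_mul, smul_monomial, e]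
      have hs : (monomial b s : MvPolynomial (Fin n) R) = s • monomial b 1 := by
        simp [smul_monomial]
      have hr : (monomial a r : MvPolynomial (Fin n) R) = r • monomial a 1 := by
        simp [smul_monomial]
      rw [h, map_smul, applyY, Module.Basis.constr_basis, hs, hr, map_smul]
      simp only [Equiv.apply_symm_apply, smul_smul, smul_eq_mul]
      congr 1
      ring

/-- `det ‖∇f(x, y)‖`, where `Df i` is `∇f_i(x, y)`, placed in the `i`-th column. -/
noncomputable def detNabla (Df : Fin n → Fin n → MvPolynomial (Fin n ⊕ Fin n) R) :
    MvPolynomial (Fin n ⊕ Fin n) R :=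
  (Matrix.of fun k i => Df i k).det

/-- The matrix with first block row `(∇f(x, y), D(x, y))` and last row `(f(x), G(x, y))`. -/
noncomputable def bordered (f : Fin n → MvPolynomial (Fin n) R)
    (Df : Fin n → Fin n → MvPolynomial (Fin n ⊕ Fin n) R)
    (D : Fin n → MvPolynomial (Fin n ⊕ Fin n) R) (G : MvPolynomial (Fin n ⊕ Fin n) R) :
    Matrix (Fin n ⊕ Unit) (Fin n ⊕ Unit) (MvPolynomial (Fin n ⊕ Fin n) R) :=
  Matrix.fromBlocks (Matrix.of fun k i => Df i k) (Matrix.of fun k _ => D k)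
    (Matrix.of fun _ i => inX (f i)) (Matrix.of fun _ _ => G)

theorem bordered_eq_updateCol (f : Fin n → MvPolynomial (Fin n) R)
    (Df : Fin n → Fin n → MvPolynomial (Fin n ⊕ Fin n) R)
    (D : Fin n → MvPolynomial (Fin n ⊕ Fin n) R) (G : MvPolynomial (Fin n ⊕ Fin n) R) :
    bordered f Df D G =
      (bordered f Df 0 0).updateCol (Sum.inr ()) (Sum.elim D fun _ => G) := by
  ext i j
  rcases i with i | i <;> rcases j with j | j <;> simp [bordered]

/-- The operator `[L(x_*)]`, sending `F(x)` to
`L(y_*).det ‖∇f(x, y), ∇F(x, y); f(x), F(x)‖`. -/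
noncomputable def op (f : Fin n → MvPolynomial (Fin n) R)
    (Df : Fin n → Fin n → MvPolynomial (Fin n ⊕ Fin n) R)
    (nab : MvPolynomial (Fin n) R →ₗ[R] (Fin n → MvPolynomial (Fin n ⊕ Fin n) R))
    (L : Functional n R) : MvPolynomial (Fin n) R →ₗ[R] MvPolynomial (Fin n) R where
  toFun F := applyY L (bordered f Df (nab F) (inX F)).det
  map_add' F G := by
    have h : (Sum.elim (nab (F + G)) fun _ : Unit => inX (F + G)) =
        (Sum.elim (nab F) fun _ : Unit => inX F) + Sum.elim (nab G) fun _ : Unit => inX G := by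
      ext1 i
      rcases i with i | i <;> simp [inX]
    rw [bordered_eq_updateCol, bordered_eq_updateCol f Df (nab F),
      bordered_eq_updateCol f Df (nab G), h, Matrix.det_updateCol_add, map_add]
  map_smul' c F := by
    have h : (Sum.elim (nab (c • F)) fun _ : Unit => inX (c • F)) =
        (C c : MvPolynomial (Fin n ⊕ Fin n) R) • (Sum.elim (nab F) fun _ : Unit => inX F) := by
      ext1 i
      rcases i with i | i <;> simp [inX, ← MvPolynomial.smul_eq_C_mul]
    rw [bordered_eq_updateCol, bordered_eq_updateCol f Df (nab F), h,
      Matrix.det_updateCol_smul, ← MvPolynomial.smul_eq_C_mul, map_smul]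
    rfl

/-- The extension `l(x_*) * L(x_*) = l(x_*).[L(x_*)]` of functionals. -/
noncomputable def extend (f : Fin n → MvPolynomial (Fin n) R)
    (Df : Fin n → Fin n → MvPolynomial (Fin n ⊕ Fin n) R)
    (nab : MvPolynomial (Fin n) R →ₗ[R] (Fin n → MvPolynomial (Fin n ⊕ Fin n) R))
    (l L : Functional n R) : Functional n R :=
  l ∘ₗ op f Df nab L

/-- The functional `L(x_*)·G(x)`, with `(L(x_*)·G(x)).F(x) = L(x_*).G(x)F(x)`. -/
noncomputable def mulPoly (L : Functional n R) (G : MvPolynomial (Fin n) R) : Functional n R :=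
  L ∘ₗ LinearMap.mulLeft R G

/-- `E` is a unit root functional of `f`: it annuls `(f(x))_x` and `E * 1 - 1 ∈ (f(x))_x`. -/
def IsUnitRootFunctional (f : Fin n → MvPolynomial (Fin n) R)
    (Df : Fin n → Fin n → MvPolynomial (Fin n ⊕ Fin n) R)
    (nab : MvPolynomial (Fin n) R →ₗ[R] (Fin n → MvPolynomial (Fin n ⊕ Fin n) R))
    (E : Functional n R) : Prop :=
  AnnulsIdeal E f ∧ op f Df nab E 1 - 1 ∈ idealOf f

end RootFunctional

/-!
Write `B(x, y) = det ∇f(x, y)`, a polynomial of total degree at most `δ_f` (`detNabla_mem_degLE`).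
The bordered determinant defining `L * F` has two expansions. Modulo the entries `f(x)` of its last
row it is `F(x) B(x, y)`, so `L * F` is `F · (L(y_*).B)` modulo `(f(x))_x` for every `L`
(`op_sub_mul_mem_idealOf`). Subtracting `x_k - y_k` times the `k`-th row from the last one turns
that row into `(f(y), F(y))`; so if `L` annuls the ideal, then `L * F = L(y_*).F(y) B(x, y)`
exactly (`op_eq_of_annulsIdeal`), which has degree at most `δ_f` in `x`. As `E * 1 - 1` is in the
ideal, the two together say that `F ↦ E * F` reduces every polynomial modulo the ideal to one of
degree at most `δ_f`. This is part 1, and it gives `l * E = l` for `l` annulling the ideal.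

For `E * l = l`, the form `(F, G) ↦ E(FG)` is nondegenerate modulo the ideal: if `E(GF) = 0` for
all `F`, then `G ≡ E * G = 0` (`mem_idealOf_of_forall_mul_eq_zero`). Let `e(y) = E(x_*).B(x, y)`.
Then `E(eF) = E(E * F) = E(F)` for all `F`, hence `e ≡ 1`, although `B` is not assumed to be
symmetric in `x` and `y`. Exchanging the order in which `E` and `l` are applied now gives
`(E * l)(F) = l(eF) = l(F)`.

Both `E * L'` and `L' * E` depend only on the values of `L'` in degrees at most `δ_f`, which
gives parts 3 and 5. Part 4 is part 3 applied to `l = L * E`.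
-/

namespace RootFunctional

/-! ### Polynomials of bounded degree -/

theorem degLE_mono {σ R : Type*} [CommRing R] {d e : ℤ} (h : d ≤ e) :
    degLE σ R d ≤ degLE σ R e :=
  fun _ hF s hs => (hF s hs).trans h

theorem mul_mem_degLE {σ R : Type*} [CommRing R] {d e : ℤ} {F G : MvPolynomial σ R}
    (hF : F ∈ degLE σ R d) (hG : G ∈ degLE σ R e) : F * G ∈ degLE σ R (d + e) := by
  classical
  intro s hs
  obtain ⟨a, ha, b, hb, rfl⟩ := Finset.mem_add.1 (support_mul F G hs)
  have h₁ := hF a ha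
  have h₂ := hG b hb
  rw [map_add]
  push_cast
  linarith

theorem one_mem_degLE {σ R : Type*} [CommRing R] : (1 : MvPolynomial σ R) ∈ degLE σ R 0 := by
  classical
  intro s hs
  rw [mem_support_iff, coeff_one] at hs
  have h : 0 = s := by
    by_contra h
    simp [h] at hs
  simp [← h]

theorem prod_mem_degLE {ι σ R : Type*} [CommRing R] (t : Finset ι) (d : ι → ℤ)
    (F : ι → MvPolynomial σ R) (h : ∀ i ∈ t, F i ∈ degLE σ R (d i)) :
    ∏ i ∈ t, F i ∈ degLE σ R (∑ i ∈ t, d i) := by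
  classical
  induction t using Finset.induction_on with
  | empty => simpa using one_mem_degLE
  | insert i t hi ih =>
    rw [Finset.prod_insert hi, Finset.sum_insert hi]
    exact mul_mem_degLE (h i (Finset.mem_insert_self i t))
      (ih fun j hj => h j (Finset.mem_insert_of_mem hj))

theorem detNabla_mem_degLE {n : ℕ} {R : Type*} [CommRing R] {f : Fin n → MvPolynomial (Fin n) R}
    {Df : Fin n → Fin n → MvPolynomial (Fin n ⊕ Fin n) R} (hDf : ∀ i, IsNabla (f i) (Df i)) :
    detNabla Df ∈ degLE (Fin n ⊕ Fin n) R (delta f) := by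
  rw [detNabla, Matrix.det_apply']
  refine Submodule.sum_mem _ fun σ _ => ?_
  have h : ∏ i, (Matrix.of fun k i => Df i k) (σ i) i ∈
      degLE (Fin n ⊕ Fin n) R (delta f) :=
    prod_mem_degLE _ _ _ fun i _ => (hDf i).2 (σ i)
  rcases Int.units_eq_one_or (Equiv.Perm.sign σ) with hs | hs
  · simpa [hs] using h
  · simpa [hs] using h

/-! ### Applying a functional to one of the two groups of variables -/

section ApplyY

variable {n : ℕ} {R : Type*} [CommRing R]

theorem monomial_eq_inX_mul_inY (m : Fin n ⊕ Fin n →₀ ℕ) :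
    (monomial m 1 : MvPolynomial (Fin n ⊕ Fin n) R) =
      inX (monomial (Finsupp.sumFinsuppEquivProdFinsupp m).1 1) *
        inY (monomial (Finsupp.sumFinsuppEquivProdFinsupp m).2 1) := by
  have e : (Finsupp.sumFinsuppEquivProdFinsupp m).1.mapDomain Sum.inl +
      (Finsupp.sumFinsuppEquivProdFinsupp m).2.mapDomain Sum.inr = m := by
    ext i
    rcases i with i | i
    · simp [Finsupp.mapDomain_apply Sum.inl_injective, Finsupp.mapDomain_of_notMem_range]
    · simp [Finsupp.mapDomain_apply Sum.inr_injective, Finsupp.mapDomain_of_notMem_range]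
  simp only [inX, inY, rename_monomial, monomial_mul, mul_one, e]

/-- `R[x, y]` is spanned by the products `P(x) Q(y)`. -/
theorem linearMap_ext_inX_mul_inY {M : Type*} [AddCommGroup M] [Module R M]
    {u v : MvPolynomial (Fin n ⊕ Fin n) R →ₗ[R] M}
    (h : ∀ P Q, u (inX P * inY Q) = v (inX P * inY Q)) : u = v :=
  (basisMonomials (Fin n ⊕ Fin n) R).ext fun m => by
    simp only [coe_basisMonomials]
    rw [monomial_eq_inX_mul_inY]
    exact h _ _

theorem applyY_inX_mul (L : Functional n R) (P : MvPolynomial (Fin n) R)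
    (G : MvPolynomial (Fin n ⊕ Fin n) R) : applyY L (inX P * G) = P * applyY L G := by
  have h : applyY L ∘ₗ LinearMap.mulLeft R (inX P) = LinearMap.mulLeft R P ∘ₗ applyY L := by
    refine linearMap_ext_inX_mul_inY fun A B => ?_
    have e : inX P * (inX A * inY B) = inX (P * A) * inY B := by
      simp only [inX, map_mul, mul_assoc]
    simp [e, applyY_inX_mul_inY]
  exact LinearMap.congr_fun h G

theorem applyY_inY_mul (L : Functional n R) (Q : MvPolynomial (Fin n) R)
    (G : MvPolynomial (Fin n ⊕ Fin n) R) : applyY L (inY Q * G) = applyY (mulPoly L Q) G := by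
  have h : applyY L ∘ₗ LinearMap.mulLeft R (inY Q) = applyY (mulPoly L Q) := by
    refine linearMap_ext_inX_mul_inY fun A B => ?_
    have e : inY Q * (inX A * inY B) = inX A * inY (Q * B) := by
      simp only [inY, map_mul]
      ring
    simp [e, applyY_inX_mul_inY, mulPoly]
  exact LinearMap.congr_fun h G

theorem applyY_inY_mul_eq_zero {L : Functional n R} {Q : MvPolynomial (Fin n) R}
    (h : ∀ P, L (Q * P) = 0) (G : MvPolynomial (Fin n ⊕ Fin n) R) :
    applyY L (inY Q * G) = 0 := by
  have h₁ : applyY L ∘ₗ LinearMap.mulLeft R (inY Q) = 0 := by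
    refine linearMap_ext_inX_mul_inY fun A B => ?_
    have e : inY Q * (inX A * inY B) = inX A * inY (Q * B) := by
      simp only [inY, map_mul]
      ring
    simp [e, applyY_inX_mul_inY, h]
  exact LinearMap.congr_fun h₁ G

/-- Applying `l` to `y` and then `E` to `x` is the same as applying `E` to `x` and then `l`
to `y`; here `E` acts on `x` through the exchange of `x` and `y`. -/
theorem apply_applyY_comm (E l : Functional n R) (G : MvPolynomial (Fin n ⊕ Fin n) R) :
    E (applyY l G) = l (applyY E (rename Sum.swap G)) := by
  have h : E ∘ₗ applyY l = l ∘ₗ applyY E ∘ₗ (rename Sum.swap).toLinearMap := by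
    refine linearMap_ext_inX_mul_inY fun A B => ?_
    have e : rename Sum.swap (inX A * inY B) = inX B * inY A := by
      simp [inX, inY, rename_rename, Function.comp_def, mul_comm]
    simp [e, applyY_inX_mul_inY, mul_comm]
  exact LinearMap.congr_fun h G

theorem applyY_monomial (L : Functional n R) (m : Fin n ⊕ Fin n →₀ ℕ) (c : R) :
    applyY L (monomial m c) =
      c • L (monomial (Finsupp.sumFinsuppEquivProdFinsupp m).2 1) •
        monomial (Finsupp.sumFinsuppEquivProdFinsupp m).1 1 := by
  have h : (monomial m c : MvPolynomial (Fin n ⊕ Fin n) R) = c • monomial m 1 := by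
    simp [smul_monomial]
  rw [h, monomial_eq_inX_mul_inY, map_smul, applyY_inX_mul_inY]

theorem degree_eq_add (m : Fin n ⊕ Fin n →₀ ℕ) :
    m.degree = (Finsupp.sumFinsuppEquivProdFinsupp m).1.degree +
      (Finsupp.sumFinsuppEquivProdFinsupp m).2.degree := by
  simp [Finsupp.degree_eq_sum]

theorem monomial_mem_degLE {σ : Type*} {d : ℤ} {s : σ →₀ ℕ} (h : (s.degree : ℤ) ≤ d) (c : R) :
    monomial s c ∈ degLE σ R d := by
  intro t ht
  rw [Finset.mem_singleton.1 (support_monomial_subset ht)]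
  exact h

theorem applyY_mem_degLE (L : Functional n R) {d : ℤ} {G : MvPolynomial (Fin n ⊕ Fin n) R}
    (hG : G ∈ degLE (Fin n ⊕ Fin n) R d) : applyY L G ∈ degLE (Fin n) R d := by
  rw [G.as_sum, map_sum]
  refine Submodule.sum_mem _ fun m hm => ?_
  rw [applyY_monomial]
  refine Submodule.smul_mem _ _ (Submodule.smul_mem _ _ (monomial_mem_degLE ?_ 1))
  have h := hG m hm
  rw [degree_eq_add] at h
  omega

theorem applyY_congr_of_mem_degLE {L L' : Functional n R} {d : ℤ}
    (h : ∀ F ∈ degLE (Fin n) R d, L' F = L F) {G : MvPolynomial (Fin n ⊕ Fin n) R}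
    (hG : G ∈ degLE (Fin n ⊕ Fin n) R d) : applyY L' G = applyY L G := by
  rw [G.as_sum, map_sum, map_sum]
  refine Finset.sum_congr rfl fun m hm => ?_
  rw [applyY_monomial, applyY_monomial, h]
  refine monomial_mem_degLE ?_ 1
  have h := hG m hm
  rw [degree_eq_add] at h
  omega

end ApplyY

/-! ### The two expansions of the bordered determinant -/

theorem det_fromBlocks_sub_mul_det_mem {m S : Type*} [Fintype m] [DecidableEq m] [CommRing S]
    (I : Ideal S) (A : Matrix m m S) (b : m → S) (c : m → S) (d : S) (hc : ∀ i, c i ∈ I) :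
    (Matrix.fromBlocks A (Matrix.of fun k (_ : Unit) => b k) (Matrix.of fun (_ : Unit) i => c i)
      (Matrix.of fun _ _ => d)).det - d * A.det ∈ I := by
  rw [← Ideal.Quotient.mk_eq_mk_iff_sub_mem, map_mul, RingHom.map_det, RingHom.map_det]
  have h : (Ideal.Quotient.mk I).mapMatrix (Matrix.fromBlocks A
      (Matrix.of fun k (_ : Unit) => b k) (Matrix.of fun (_ : Unit) i => c i)
      (Matrix.of fun _ _ => d)) = Matrix.fromBlocks ((Ideal.Quotient.mk I).mapMatrix A)
      (Matrix.of fun k (_ : Unit) => Ideal.Quotient.mk I (b k)) 0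
      (Matrix.of fun _ _ => Ideal.Quotient.mk I d) := by
    ext i j
    rcases i with i | i <;> rcases j with j | j <;>
      simp [Ideal.Quotient.eq_zero_iff_mem.2 (hc _)]
  rw [h, Matrix.det_fromBlocks_zero₂₁, Matrix.det_unique (n := Unit), mul_comm, Matrix.of_apply]

section Operator

variable {n : ℕ} {R : Type*} [CommRing R] {f : Fin n → MvPolynomial (Fin n) R}
  {Df : Fin n → Fin n → MvPolynomial (Fin n ⊕ Fin n) R}
  {nab : MvPolynomial (Fin n) R →ₗ[R] (Fin n → MvPolynomial (Fin n ⊕ Fin n) R)}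

/-- Subtracting `x_k - y_k` times the `k`-th row from the last row replaces `x` by `y` there. -/
theorem det_bordered_eq (hDf : ∀ i, IsNabla (f i) (Df i)) {F : MvPolynomial (Fin n) R}
    {D : Fin n → MvPolynomial (Fin n ⊕ Fin n) R} (hD : IsNabla F D) :
    (bordered f Df D (inX F)).det =
      (Matrix.fromBlocks (Matrix.of fun k i => Df i k) (Matrix.of fun k (_ : Unit) => D k)
        (Matrix.of fun (_ : Unit) i => inY (f i)) (Matrix.of fun _ _ => inY F)).det := by
  have h : bordered f Df D (inX F) =
      Matrix.fromBlocks (1 : Matrix (Fin n) (Fin n) (MvPolynomial (Fin n ⊕ Fin n) R)) 0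
        (Matrix.of fun (_ : Unit) k => X (Sum.inl k) - X (Sum.inr k)) 1 *
      Matrix.fromBlocks (Matrix.of fun k i => Df i k) (Matrix.of fun k (_ : Unit) => D k)
        (Matrix.of fun (_ : Unit) i => inY (f i)) (Matrix.of fun _ _ => inY F) := by
    rw [Matrix.fromBlocks_multiply, bordered]
    congr 1
    · simp
    · simp
    · ext1 _ i
      simp [Matrix.mul_apply, ← (hDf i).1]
    · ext1 _ i
      simp [Matrix.mul_apply, ← hD.1]
  rw [h, Matrix.det_mul, Matrix.det_fromBlocks_zero₁₂]
  simp

theorem applyY_mem_idealOf (L : Functional n R) {G : MvPolynomial (Fin n ⊕ Fin n) R}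
    (hG : G ∈ Ideal.span (Set.range fun i => inX (f i))) : applyY L G ∈ idealOf f := by
  obtain ⟨c, rfl⟩ := (Ideal.mem_span_range_iff_exists_fun).1 hG
  rw [map_sum]
  refine Ideal.sum_mem _ fun i _ => ?_
  rw [mul_comm, applyY_inX_mul]
  exact Ideal.mul_mem_right _ _ (Ideal.subset_span ⟨i, rfl⟩)

theorem applyY_eq_zero_of_annulsIdeal {L : Functional n R} (hL : AnnulsIdeal L f)
    {G : MvPolynomial (Fin n ⊕ Fin n) R}
    (hG : G ∈ Ideal.span (Set.range fun i => inY (f i))) : applyY L G = 0 := by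
  obtain ⟨c, rfl⟩ := (Ideal.mem_span_range_iff_exists_fun).1 hG
  rw [map_sum]
  refine Finset.sum_eq_zero fun i _ => ?_
  rw [mul_comm]
  exact applyY_inY_mul_eq_zero
    (fun P => hL _ (Ideal.mul_mem_right _ _ (Ideal.subset_span ⟨i, rfl⟩))) _

theorem op_sub_mul_mem_idealOf (L : Functional n R) (F : MvPolynomial (Fin n) R) :
    op f Df nab L F - F * applyY L (detNabla Df) ∈ idealOf f := by
  rw [← applyY_inX_mul]
  change applyY L _ - _ ∈ _
  rw [← map_sub]
  exact applyY_mem_idealOf L (det_fromBlocks_sub_mul_det_mem _ _ _ (fun i => inX (f i)) _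
    fun i => Ideal.subset_span ⟨i, rfl⟩)

theorem op_eq_of_annulsIdeal (hDf : ∀ i, IsNabla (f i) (Df i)) (hnab : IsNablaOperator nab)
    {L : Functional n R} (hL : AnnulsIdeal L f) (F : MvPolynomial (Fin n) R) :
    op f Df nab L F = applyY L (inY F * detNabla Df) := by
  change applyY L _ = _
  rw [det_bordered_eq hDf (hnab F), ← sub_eq_zero, ← map_sub]
  exact applyY_eq_zero_of_annulsIdeal hL (det_fromBlocks_sub_mul_det_mem _ _ _
    (fun i => inY (f i)) _ fun i => Ideal.subset_span ⟨i, rfl⟩)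

theorem op_mem_degLE (hDf : ∀ i, IsNabla (f i) (Df i)) (hnab : IsNablaOperator nab)
    {L : Functional n R} (hL : AnnulsIdeal L f) (F : MvPolynomial (Fin n) R) :
    op f Df nab L F ∈ degLE (Fin n) R (delta f) := by
  rw [op_eq_of_annulsIdeal hDf hnab hL, applyY_inY_mul]
  exact applyY_mem_degLE _ (detNabla_mem_degLE hDf)

theorem extend_eq_mulPoly {l : Functional n R} (hl : AnnulsIdeal l f) (L : Functional n R) :
    extend f Df nab l L = mulPoly l (applyY L (detNabla Df)) := by
  refine LinearMap.ext fun F => ?_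
  have h := hl _ (op_sub_mul_mem_idealOf (Df := Df) (nab := nab) L F)
  rw [map_sub, sub_eq_zero] at h
  simpa [extend, mulPoly, mul_comm] using h

/-! ### Consequences for a unit root functional -/

variable {E : Functional n R}

theorem sub_op_mem_idealOf (hDf : ∀ i, IsNabla (f i) (Df i)) (hnab : IsNablaOperator nab)
    (hE : IsUnitRootFunctional f Df nab E) (F : MvPolynomial (Fin n) R) :
    F - op f Df nab E F ∈ idealOf f := by
  have h₁ := op_sub_mul_mem_idealOf (f := f) (Df := Df) (nab := nab) E F
  have h₂ : applyY E (detNabla Df) - 1 ∈ idealOf f := by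
    have h := hE.2
    rwa [op_eq_of_annulsIdeal hDf hnab hE.1, inY, map_one, one_mul] at h
  have h := Ideal.add_mem _ h₁ (Ideal.mul_mem_left _ F h₂)
  rw [← neg_mem_iff] at h
  convert h using 1
  ring

theorem extend_unit_right (hDf : ∀ i, IsNabla (f i) (Df i)) (hnab : IsNablaOperator nab)
    (hE : IsUnitRootFunctional f Df nab E) {l : Functional n R} (hl : AnnulsIdeal l f) :
    l = extend f Df nab l E := by
  refine LinearMap.ext fun F => ?_
  have h := hl _ (sub_op_mem_idealOf hDf hnab hE F)
  rwa [map_sub, sub_eq_zero] at h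

/-- The form `(F, G) ↦ E(GF)` is nondegenerate modulo the ideal. -/
theorem mem_idealOf_of_forall_mul_eq_zero (hDf : ∀ i, IsNabla (f i) (Df i))
    (hnab : IsNablaOperator nab) (hE : IsUnitRootFunctional f Df nab E)
    {G : MvPolynomial (Fin n) R} (h : ∀ F, E (G * F) = 0) : G ∈ idealOf f := by
  have h₁ := sub_op_mem_idealOf hDf hnab hE G
  rwa [op_eq_of_annulsIdeal hDf hnab hE.1, applyY_inY_mul_eq_zero h, sub_zero] at h₁

theorem extend_apply_eq_apply_mul (hDf : ∀ i, IsNabla (f i) (Df i)) (hnab : IsNablaOperator nab)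
    (l : Functional n R) {L : Functional n R} (hL : AnnulsIdeal L f)
    (F : MvPolynomial (Fin n) R) :
    extend f Df nab l L F = L (F * applyY l (rename Sum.swap (detNabla Df))) := by
  have e : rename Sum.swap (inY F * detNabla Df) = inX F * rename Sum.swap (detNabla Df) := by
    simp [inX, inY, rename_rename, Function.comp_def]
  rw [extend, LinearMap.comp_apply, op_eq_of_annulsIdeal hDf hnab hL, apply_applyY_comm, e,
    applyY_inX_mul]

/-- `E(x_*).det ∇f(x, y)` is `1` modulo the ideal. -/
theorem applyY_swap_detNabla_sub_one_mem (hDf : ∀ i, IsNabla (f i) (Df i))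
    (hnab : IsNablaOperator nab) (hE : IsUnitRootFunctional f Df nab E) :
    applyY E (rename Sum.swap (detNabla Df)) - 1 ∈ idealOf f := by
  refine mem_idealOf_of_forall_mul_eq_zero hDf hnab hE fun F => ?_
  rw [sub_mul, one_mul, map_sub, mul_comm, ← extend_apply_eq_apply_mul hDf hnab E hE.1,
    ← extend_unit_right hDf hnab hE hE.1, sub_self]

theorem extend_unit_left (hDf : ∀ i, IsNabla (f i) (Df i)) (hnab : IsNablaOperator nab)
    (hE : IsUnitRootFunctional f Df nab E) {l : Functional n R} (hl : AnnulsIdeal l f) :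
    l = extend f Df nab E l := by
  refine LinearMap.ext fun F => ?_
  have h := hl _ (Ideal.mul_mem_left _ F (applyY_swap_detNabla_sub_one_mem hDf hnab hE))
  rw [mul_sub, mul_one, map_sub, sub_eq_zero] at h
  rw [extend_apply_eq_apply_mul hDf hnab E hl, h]

theorem extend_unit_of_eqOn_degLE (hDf : ∀ i, IsNabla (f i) (Df i)) (hnab : IsNablaOperator nab)
    (hE : IsUnitRootFunctional f Df nab E) {l L' : Functional n R} (hl : AnnulsIdeal l f)
    (h : ∀ F ∈ degLE (Fin n) R (delta f), L' F = l F) :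
    l = extend f Df nab E L' ∧ l = extend f Df nab L' E := by
  constructor
  · rw [extend_eq_mulPoly hE.1, applyY_congr_of_mem_degLE h (detNabla_mem_degLE hDf),
      ← extend_eq_mulPoly (nab := nab) hE.1]
    exact extend_unit_left hDf hnab hE hl
  · refine LinearMap.ext fun F => ?_
    rw [extend, LinearMap.comp_apply, h _ (op_mem_degLE hDf hnab hE.1 F)]
    exact LinearMap.congr_fun (extend_unit_right hDf hnab hE hl) F

theorem sub_op_mem_degLE (hDf : ∀ i, IsNabla (f i) (Df i)) (hnab : IsNablaOperator nab)
    {L : Functional n R} (hL : AnnulsIdeal L f) {d : ℤ} {F : MvPolynomial (Fin n) R}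
    (hF : F ∈ degLE (Fin n) R d) :
    F - op f Df nab L F ∈ degLE (Fin n) R (max (delta f) d) :=
  Submodule.sub_mem _ (degLE_mono (le_max_right _ _) hF)
    (degLE_mono (le_max_left _ _) (op_mem_degLE hDf hnab hL F))

end Operator

end RootFunctional

open RootFunctional in
theorem theorem6 {R : Type*} [CommRing R] {n : ℕ}
    (f : Fin n → MvPolynomial (Fin n) R)
    (Df : Fin n → Fin n → MvPolynomial (Fin n ⊕ Fin n) R)
    (hDf : ∀ i, RootFunctional.IsNabla (f i) (Df i))
    (nab : MvPolynomial (Fin n) R →ₗ[R] (Fin n → MvPolynomial (Fin n ⊕ Fin n) R))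
    (hnab : RootFunctional.IsNablaOperator nab)
    (E : RootFunctional.Functional n R)
    (hE : RootFunctional.IsUnitRootFunctional f Df nab E) :
    -- 1)
    (∀ (d : ℤ), ∀ F ∈ RootFunctional.degLE (Fin n) R d,
      RootFunctional.op f Df nab E F ∈
          RootFunctional.degLE (Fin n) R (RootFunctional.delta f) ∧
        F - RootFunctional.op f Df nab E F ∈ RootFunctional.idealOf f ∧
        F - RootFunctional.op f Df nab E F ∈
          RootFunctional.degLE (Fin n) R (max (RootFunctional.delta f) d)) ∧
    -- 2)
    (∀ l : RootFunctional.Functional n R, RootFunctional.AnnulsIdeal l f →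
      l = RootFunctional.extend f Df nab E l ∧
        l = RootFunctional.extend f Df nab l E ∧
        l = RootFunctional.mulPoly E
          (RootFunctional.applyY l (RootFunctional.detNabla Df))) ∧
    -- 3)
    (∀ (δ : ℕ) (l L' : RootFunctional.Functional n R), RootFunctional.AnnulsIdeal l f →
      (∀ F ∈ RootFunctional.degLE (Fin n) R (RootFunctional.delta f + δ), L' F = l F) →
      l = RootFunctional.extend f Df nab E L' ∧ l = RootFunctional.extend f Df nab L' E) ∧
    -- 4)
    (∀ (δ : ℕ) (L : RootFunctional.Functional n R),
      (∀ F ∈ RootFunctional.idealOf f,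
        F ∈ RootFunctional.degLE (Fin n) R (RootFunctional.delta f + δ) → L F = 0) →
      (∀ F ∈ RootFunctional.degLE (Fin n) R (RootFunctional.delta f + δ),
        L F = RootFunctional.extend f Df nab E L F ∧
          L F = RootFunctional.extend f Df nab L E F) ∧
      RootFunctional.extend f Df nab E L = RootFunctional.extend f Df nab L E ∧
      RootFunctional.AnnulsIdeal (RootFunctional.extend f Df nab E L) f) ∧
    -- 5)
    (∀ (δ : ℕ) (l l' : RootFunctional.Functional n R),
      RootFunctional.AnnulsIdeal l f → RootFunctional.AnnulsIdeal l' f →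
      (∀ F ∈ RootFunctional.degLE (Fin n) R (RootFunctional.delta f + δ), l F = l' F) →
      l = l') := by
  have le_add (δ : ℕ) : delta f ≤ delta f + δ := by omega
  have eq_of_agree (δ : ℕ) (l L' : Functional n R) (hl : AnnulsIdeal l f)
      (h : ∀ F ∈ degLE (Fin n) R (delta f + δ), L' F = l F) :
      l = extend f Df nab E L' ∧ l = extend f Df nab L' E :=
    extend_unit_of_eqOn_degLE hDf hnab hE hl fun F hF => h F (degLE_mono (le_add δ) hF)
  refine ⟨fun d F hF => ⟨op_mem_degLE hDf hnab hE.1 F, sub_op_mem_idealOf hDf hnab hE F,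
    sub_op_mem_degLE hDf hnab hE.1 hF⟩, fun l hl => ?_, eq_of_agree, fun δ L hL => ?_,
    fun δ l l' hl hl' h => ?_⟩
  · have h := extend_unit_left hDf hnab hE hl
    refine ⟨h, extend_unit_right hDf hnab hE hl, ?_⟩
    rwa [extend_eq_mulPoly hE.1] at h
  · have hagree : ∀ F ∈ degLE (Fin n) R (delta f + δ), L F = extend f Df nab L E F := by
      intro F hF
      have hdeg := sub_op_mem_degLE hDf hnab hE.1 hF
      rw [max_eq_right (le_add δ)] at hdeg
      have h := hL _ (sub_op_mem_idealOf hDf hnab hE F) hdeg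
      rwa [map_sub, sub_eq_zero] at h
    have hann : AnnulsIdeal (extend f Df nab L E) f := by
      intro F hF
      refine hL _ ?_ (degLE_mono (le_add δ) (op_mem_degLE hDf hnab hE.1 F))
      have h := Ideal.sub_mem _ hF (sub_op_mem_idealOf hDf hnab hE F)
      rwa [sub_sub_cancel] at h
    have heq := (eq_of_agree δ _ L hann hagree).1
    rw [← heq]
    exact ⟨fun F hF => ⟨hagree F hF, hagree F hF⟩, rfl, hann⟩
  · exact (eq_of_agree δ l l' hl fun F hF => (h F hF).symm).1.trans
      (extend_unit_left hDf hnab hE hl').symm
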